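/- A \emph{lattice-ordered abelian group} is an abelian group $(A,\cdot,e)$ with a lattice order such that $x(y\vee z)=xy\vee xz$ for all $x,y,z\in A$; a morphism is a group homomorphism which preserves binary joins. Let $\ell\mathbb{A}b$ be the resulting category. For an object $Y$ of a category $\mathbb{C}$ with finite limits, the category of points $\mathrm{Pt}_Y(\mathbb{C})$ has as objects the triples $(A,p,s)$ with $p\colon A\to Y$, $s\colon Y\to A$ and $ps=\mathrm{id}_Y$, and as morphisms the arrows of $\mathbb{C}$ that commute with the projections $p$ and with the sections $s$. For $f\colon X\to Y$, pulling back along $f$ defines the change-of-base functor $f^*\colon \mathrm{Pt}_Y(\mathbb{C})\to \mathrm{Pt}_X(\mathbb{C})$. A pair of arrows with common codomain $B$ is \emph{jointly extremally epimorphic} if every monomorphism into $B$ through which both arrows factor is an isomorphism. A functor between categories with finite limits is \emph{coherent} if it preserves finite limits and jointly extremally epimorphic pairs. A category $\mathbb{C}$ with finite limits is \emph{algebraically coherent} if $f^*$ is coherent for every arrow $f$ of $\mathbb{C}$. It is \emph{pointed protomodular} if it has a zero object and $f^*$ reflects isomorphisms for every arrow $f$ of $\mathbb{C}$. Let $\mathbb{C}$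 be pointed protomodular and $X$ an object of $\mathbb{C}$. A \emph{split extension} with kernel object $X$ consists of arrows $k\colon X\to A$, $p\colon A\to B$ and $s\colon B\to A$ with $ps=\mathrm{id}_B$ and $k$ a kernel of $p$. A morphism from $(A,B,k,p,s)$ to $(A',B',k',p',s')$ is a pair $g\colon A\to A'$, $h\colon B\to B'$ with $gk=k'$, $hp=p'g$ and $gs=s'h$. A split extension $F$ with kernel object $X$ is \emph{faithful} if every split extension with kernel object $X$ has at most one morphism to $F$. The category $\mathbb{C}$ is \emph{action accessible} if, for every object $X$, every split extension with kernel object $X$ has a morphism to a faithful one. \textbf{Proposition.} The category $\ell\mathbb{A}b$ is algebraically coherent: it has finite limits and, for every morphism $f\colon X\to Y$ in $\ell\mathbb{A}b$, the change-of-base functor $f^*\colon \mathrm{Pt}_Y(\ell\mathbb{A}b)\to \mathrm{Pt}_X(\ell\mathbb{A}b)$ is coherent. Moreover, $\ell\mathbb{A}b$ is pointed protomodular and is not action accessible. -/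

import Mathlib

open CategoryTheory CategoryTheory.Limits

universe v v₁ v₂ u u₁ u₂

/-! ### The category of lattice-ordered abelian groups -/

/-- A lattice-ordered abelian group, written multiplicatively: a commutative group with a lattice
order that is invariant under translations (equivalently, the product distributes over joins). -/
structure LAb : Type (u + 1) where
  carrier : Type u
  [commGroup : CommGroup carrier]
  [lattice : Lattice carrier]
  [isOrderedMonoid : IsOrderedMonoid carrier]

namespace LAb

instance : CoeSort LAb.{u} (Type u) := ⟨LAb.carrier⟩

attribute [instance] commGroup lattice isOrderedMonoid

/-- A morphism: a group homomorphism which preserves binary joins. -/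
@[ext]
structure Hom (A B : LAb.{u}) where
  toMonoidHom : A →* B
  map_sup' : ∀ x y : A, toMonoidHom (x ⊔ y) = toMonoidHom x ⊔ toMonoidHom y

instance (A B : LAb.{u}) : FunLike (Hom A B) A B where
  coe f := f.toMonoidHom
  coe_injective _ _ h := Hom.ext (DFunLike.coe_injective h)

instance : Category LAb.{u} where
  Hom A B := Hom A B
  id A := ⟨MonoidHom.id A, fun _ _ => rfl⟩
  comp f g := ⟨g.toMonoidHom.comp f.toMonoidHom, fun x y => by
    simp [f.map_sup', g.map_sup']⟩

instance : ConcreteCategory LAb.{u} (fun A B => Hom A B) where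
  hom f := f
  ofHom f := f

/-- The zero morphisms are the constant maps with value the neutral element. -/
instance : HasZeroMorphisms LAb.{u} where
  zero A B := ⟨(⟨1, fun _ _ => by simp⟩ : Hom A B)⟩
  comp_zero _ _ := rfl
  zero_comp A _ _ f := Hom.ext (MonoidHom.ext fun _ => map_one f.toMonoidHom)

end LAb

/-! ### Categories of points and change of base -/

section Points

variable {C : Type u} [Category.{v} C]

/-- A point over `Y`: a split epimorphism onto `Y` together with a chosen section. -/
structure Pt (Y : C) where
  obj : C
  proj : obj ⟶ Y
  sec : Y ⟶ obj
  sec_proj : sec ≫ proj = 𝟙 Y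

namespace Pt

/-- A morphism of points over `Y` commutes with the projections and with the sections. -/
@[ext]
structure Hom {Y : C} (A B : Pt Y) where
  hom : A.obj ⟶ B.obj
  hom_proj : hom ≫ B.proj = A.proj
  sec_hom : A.sec ≫ hom = B.sec

instance (Y : C) : Category (Pt Y) where
  Hom A B := Hom A B
  id A := ⟨𝟙 A.obj, Category.id_comp _, Category.comp_id _⟩
  comp f g := ⟨f.hom ≫ g.hom, by rw [Category.assoc, g.hom_proj, f.hom_proj], by
    rw [← Category.assoc, f.sec_hom, g.sec_hom]⟩
  id_comp f := Hom.ext (Category.id_comp f.hom)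
  comp_id f := Hom.ext (Category.comp_id f.hom)
  assoc f g h := Hom.ext (Category.assoc f.hom g.hom h.hom)

@[ext]
theorem hom_ext {Y : C} {A B : Pt Y} {f g : A ⟶ B} (h : f.hom = g.hom) : f = g :=
  Hom.ext h

@[simp]
theorem id_hom {Y : C} (A : Pt Y) : (𝟙 A : A ⟶ A).hom = 𝟙 A.obj := rfl

@[simp]
theorem comp_hom {Y : C} {A B D : Pt Y} (f : A ⟶ B) (g : B ⟶ D) :
    (f ≫ g).hom = f.hom ≫ g.hom := rfl

/-- The pullback of a point over `Y` along `f : X ⟶ Y`, with the induced section. -/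
@[simps]
noncomputable def changeOfBaseObj [HasPullbacks C] {X Y : C} (f : X ⟶ Y) (A : Pt Y) : Pt X where
  obj := pullback A.proj f
  proj := pullback.snd A.proj f
  sec := pullback.lift (f ≫ A.sec) (𝟙 X) (by
    rw [Category.assoc, A.sec_proj, Category.comp_id, Category.id_comp])
  sec_proj := pullback.lift_snd _ _ _

/-- The arrow `A ×_Y X ⟶ B ×_Y X` induced by a morphism `A ⟶ B` of points over `Y`. -/
noncomputable def pullbackMap [HasPullbacks C] {X Y : C} (f : X ⟶ Y) {A B : Pt Y} (h : A ⟶ B) :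
    pullback A.proj f ⟶ pullback B.proj f :=
  pullback.lift (pullback.fst A.proj f ≫ h.hom) (pullback.snd A.proj f) (by
    rw [Category.assoc, h.hom_proj, pullback.condition])

@[simp]
theorem pullbackMap_fst [HasPullbacks C] {X Y : C} (f : X ⟶ Y) {A B : Pt Y} (h : A ⟶ B) :
    pullbackMap f h ≫ pullback.fst B.proj f = pullback.fst A.proj f ≫ h.hom :=
  pullback.lift_fst _ _ _

@[simp]
theorem pullbackMap_snd [HasPullbacks C] {X Y : C} (f : X ⟶ Y) {A B : Pt Y} (h : A ⟶ B) :
    pullbackMap f h ≫ pullback.snd B.proj f = pullback.snd A.proj f :=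
  pullback.lift_snd _ _ _

theorem sec_pullbackMap [HasPullbacks C] {X Y : C} (f : X ⟶ Y) {A B : Pt Y} (h : A ⟶ B) :
    (changeOfBaseObj f A).sec ≫ pullbackMap f h = (changeOfBaseObj f B).sec := by
  dsimp only [changeOfBaseObj]
  apply pullback.hom_ext
  · rw [Category.assoc, pullbackMap_fst, pullback.lift_fst_assoc, pullback.lift_fst,
      Category.assoc, h.sec_hom]
  · rw [Category.assoc, pullbackMap_snd, pullback.lift_snd, pullback.lift_snd]

theorem pullbackMap_id [HasPullbacks C] {X Y : C} (f : X ⟶ Y) (A : Pt Y) :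
    pullbackMap f (𝟙 A) = 𝟙 (pullback A.proj f) := by
  apply pullback.hom_ext <;> simp

theorem pullbackMap_comp [HasPullbacks C] {X Y : C} (f : X ⟶ Y) {A B D : Pt Y}
    (g : A ⟶ B) (h : B ⟶ D) : pullbackMap f (g ≫ h) = pullbackMap f g ≫ pullbackMap f h := by
  apply pullback.hom_ext
  · rw [Category.assoc, pullbackMap_fst, pullbackMap_fst, comp_hom, ← Category.assoc,
      ← Category.assoc, pullbackMap_fst]
  · simp

/-- The change-of-base functor along `f : X ⟶ Y`, given by pulling back along `f`. -/
noncomputable def changeOfBase [HasPullbacks C] {X Y : C} (f : X ⟶ Y) : Pt Y ⥤ Pt X where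
  obj A := changeOfBaseObj f A
  map h := ⟨pullbackMap f h, pullbackMap_snd f h, sec_pullbackMap f h⟩
  map_id A := hom_ext (pullbackMap_id f A)
  map_comp g h := hom_ext (pullbackMap_comp f g h)

end Pt

end Points

/-! ### Algebraic coherence -/

/-- A pair of arrows `f : A ⟶ B`, `g : A' ⟶ B` is jointly extremally epimorphic if every
monomorphism into `B` through which both `f` and `g` factor is an isomorphism. -/
def JointlyExtremallyEpi {C : Type u} [Category.{v} C] {A A' B : C} (f : A ⟶ B) (g : A' ⟶ B) :
    Prop :=
  ∀ ⦃M : C⦄ (m : M ⟶ B) (f' : A ⟶ M) (g' : A' ⟶ M), Mono m → f' ≫ m = f → g' ≫ m = g → IsIso m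

/-- A functor is coherent if it preserves finite limits and jointly extremally epimorphic pairs. -/
structure IsCoherentFunctor {C : Type u₁} [Category.{v₁} C] {D : Type u₂} [Category.{v₂} D]
    (F : C ⥤ D) : Prop where
  preservesFiniteLimits : PreservesFiniteLimits F
  map_jointlyExtremallyEpi : ∀ {A A' B : C} (f : A ⟶ B) (g : A' ⟶ B),
    JointlyExtremallyEpi f g → JointlyExtremallyEpi (F.map f) (F.map g)

/-- A category is algebraically coherent if it has finite limits and all its change-of-base
functors between categories of points are coherent. -/
structure IsAlgebraicallyCoherent (C : Type u) [Category.{v} C] : Prop where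
  hasFiniteLimits : HasFiniteLimits C
  changeOfBase_coherent : ∀ {X Y : C} (f : X ⟶ Y), IsCoherentFunctor (Pt.changeOfBase f)

/-! ### Action accessibility -/

/-- A category is pointed protomodular if it has a zero object and finite limits, and all its
change-of-base functors between categories of points reflect isomorphisms. -/
structure IsPointedProtomodular (C : Type u) [Category.{v} C] : Prop where
  hasZeroObject : HasZeroObject C
  hasFiniteLimits : HasFiniteLimits C
  changeOfBase_reflects : ∀ {X Y : C} (f : X ⟶ Y), (Pt.changeOfBase f).ReflectsIsomorphisms

section SplitExtensions

variable {C : Type u} [Category.{v} C] [HasZeroMorphisms C]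

/-- A split extension with kernel object `X`: a split epimorphism `p : A ⟶ B` with a chosen
section `s`, together with a kernel `k : X ⟶ A` of `p`. -/
structure SplExt (X : C) where
  A : C
  B : C
  k : X ⟶ A
  p : A ⟶ B
  s : B ⟶ A
  s_p : s ≫ p = 𝟙 B
  k_p : k ≫ p = 0
  isKernel : Nonempty (IsLimit (KernelFork.ofι k k_p))

namespace SplExt

/-- A morphism of split extensions with kernel object `X`: a pair of arrows commuting with the
projections, the sections and the kernels, and inducing the identity on `X`. -/
@[ext]
structure Hom {X : C} (E F : SplExt X) where
  g : E.A ⟶ F.A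
  f : E.B ⟶ F.B
  k_g : E.k ≫ g = F.k
  p_f : E.p ≫ f = g ≫ F.p
  s_g : E.s ≫ g = f ≫ F.s

instance (X : C) : Category (SplExt X) where
  Hom E F := Hom E F
  id E := ⟨𝟙 E.A, 𝟙 E.B, by simp, by simp, by simp⟩
  comp a b := ⟨a.g ≫ b.g, a.f ≫ b.f, by rw [← Category.assoc, a.k_g, b.k_g], by
    rw [← Category.assoc, a.p_f, Category.assoc, b.p_f, Category.assoc], by
    rw [← Category.assoc, a.s_g, Category.assoc, b.s_g, Category.assoc]⟩
  id_comp a := Hom.ext (Category.id_comp a.g) (Category.id_comp a.f)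
  comp_id a := Hom.ext (Category.comp_id a.g) (Category.comp_id a.f)
  assoc a b c := Hom.ext (Category.assoc a.g b.g c.g) (Category.assoc a.f b.f c.f)

/-- A split extension `F` is faithful if every split extension with the same kernel object has at
most one morphism to `F`. -/
def IsFaithful {X : C} (F : SplExt X) : Prop :=
  ∀ (E : SplExt X) (a b : E ⟶ F), a = b

/-- A split extension is accessible if it admits a morphism to a faithful one. -/
def IsAccessible {X : C} (E : SplExt X) : Prop :=
  ∃ F : SplExt X, F.IsFaithful ∧ Nonempty (E ⟶ F)

end SplExt

end SplitExtensions

/-- The condition that defines action accessibility of a pointed protomodular category: every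
split extension is accessible. -/
def IsActionAccessible (C : Type u) [Category.{v} C] [HasZeroMorphisms C] : Prop :=
  ∀ (X : C) (E : SplExt X), E.IsAccessible

/-!
Algebraic coherence rests on one fact about abelian `ℓ`-groups. Let `B` be a point over `Y` with
kernel `K`, let `A₁` and `A₂` be `ℓ`-subgroups containing the section `Y ⟶ B` and jointly generating
`B`. Then `K` is generated by `K ∩ A₁` and `K ∩ A₂`. Indeed, let `H ≤ K` be an `ℓ`-subgroup
containing these two, and let `T ≤ H` consist of those `h` for which `y ⊓ |h|ⁿ ∈ H` for all `n` and
all positive `y` in the section. The inequality `|a|ⁿ|b|ⁿ ≤ |a|²ⁿ ⊔ |b|²ⁿ` makes `T` an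
`ℓ`-subgroup (`LatticeSubgroup.truncationStable`), and it contains `K ∩ A₁` and `K ∩ A₂` because the
truncations of an element of `K ∩ Aᵢ` stay in `K ∩ Aᵢ`. For `t ∈ T` and `y` in the section,
`t ⊔ y = (t⁺ ⊔ y⁺) / (t⁻ ⊓ y⁻)` is again a product of an element of `T` and one of the section, so
the products `T · Y` form an `ℓ`-subgroup (`LatticeSubgroup.truncationStableMul`). It contains `A₁`
and `A₂`, hence is `B`, which forces `K = T = H`.

Pulling back along `f : X ⟶ Y` does not change the kernel of a point, so the pulled back pair also
generates the kernel together with the section, hence everything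
(`LAb.jointlyExtremallyEpi_changeOfBase`). That change of base preserves finite limits is a general
fact (`Pt.preservesFiniteLimits_changeOfBase`), and protomodularity is the usual argument for groups
(`LAb.reflectsIsomorphisms_changeOfBase`).

Action accessibility fails for the lexicographic product of two copies of `ℤ`, viewed as a split
extension of the dominating factor by the infinitesimal one. Multiplication by two on the dominating
factor is an endomorphism of this split extension, so a morphism to a faithful split extension
cannot tell an element of the dominating factor from its double. It therefore kills that factor, and
by monotonicity also the kernel, which is absurd (`LAb.not_isAccessible_lexSplExt`).
-/

/-! ### Subgroups closed under joins -/

/-- An `ℓ`-subgroup: a subgroup of a lattice-ordered group which is closed under binary joins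
(hence also under binary meets, by `LatticeSubgroup.inf_mem`). -/
structure LatticeSubgroup (G : Type*) [CommGroup G] [Lattice G] extends Subgroup G where
  sup_mem' : ∀ {x y : G}, x ∈ carrier → y ∈ carrier → x ⊔ y ∈ carrier

namespace LatticeSubgroup

variable {G : Type*} [CommGroup G] [Lattice G]

instance : SetLike (LatticeSubgroup G) G where
  coe S := S.carrier
  coe_injective S T h := by
    cases S; cases T; congr; exact SetLike.coe_injective h

instance : SubgroupClass (LatticeSubgroup G) G where
  mul_mem {S} := S.mul_mem'
  one_mem S := S.one_mem'
  inv_mem {S} := S.inv_mem'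

theorem sup_mem (S : LatticeSubgroup G) {x y : G} (hx : x ∈ S) (hy : y ∈ S) : x ⊔ y ∈ S :=
  S.sup_mem' hx hy

theorem mabs_mem (S : LatticeSubgroup G) {x : G} (hx : x ∈ S) : |x|ₘ ∈ S :=
  S.sup_mem hx (inv_mem hx)

variable [IsOrderedMonoid G]

theorem inf_mem (S : LatticeSubgroup G) {x y : G} (hx : x ∈ S) (hy : y ∈ S) : x ⊓ y ∈ S := by
  rw [← inv_inv (x ⊓ y), inv_inf]
  exact inv_mem (S.sup_mem (inv_mem hx) (inv_mem hy))

end LatticeSubgroup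

section Inequalities

variable {G : Type*} [CommGroup G] [Lattice G] [IsOrderedMonoid G]

/-- Dividing by `c * d`, this says `1 ≤ |c / d|ₘ`. -/
theorem mul_le_sq_sup_sq (c d : G) : c * d ≤ c ^ 2 ⊔ d ^ 2 := by
  have h : c * d * |c / d|ₘ = c ^ 2 ⊔ d ^ 2 := by
    rw [mabs, mul_sup]
    congr 1
    · rw [pow_two, mul_assoc, mul_div_cancel]
    · rw [pow_two, inv_div, mul_comm c d, mul_assoc, mul_div_cancel]
  rw [← h]
  exact le_mul_of_one_le_right' (one_le_mabs _)

theorem mabs_sup_le_mul (a b : G) : |a ⊔ b|ₘ ≤ |a|ₘ * |b|ₘ := by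
  have ha := one_le_mabs a
  have hb := one_le_mabs b
  refine sup_le (sup_le ?_ ?_) ?_
  · exact (le_mabs_self a).trans (le_mul_of_one_le_right' hb)
  · exact (le_mabs_self b).trans (le_mul_of_one_le_left' ha)
  · exact (inv_le_inv_iff.2 le_sup_left).trans
      ((inv_le_mabs a).trans (le_mul_of_one_le_right' hb))

/-- The numerator and the denominator on the right are the positive and the negative part of
`a ⊔ b`. -/
theorem sup_eq_sup_div_inf (a b : G) :
    a ⊔ b = ((a ⊔ 1) ⊔ (b ⊔ 1)) / ((a⁻¹ ⊔ 1) ⊓ (b⁻¹ ⊔ 1)) := by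
  let := CommGroup.toDistribLattice G
  have h₁ : (a ⊔ 1) ⊔ (b ⊔ 1) = (a ⊔ b)⁺ᵐ := by
    rw [oneLePart_def, sup_sup_sup_comm, sup_idem]
  have h₂ : (a⁻¹ ⊔ 1) ⊓ (b⁻¹ ⊔ 1) = (a ⊔ b)⁻ᵐ := by
    rw [leOnePart_def, inv_sup]
    exact (sup_inf_right (α := G) a⁻¹ b⁻¹ 1).symm
  rw [h₁, h₂, oneLePart_div_leOnePart]

theorem sup_eq_mul_div_inf (a b : G) : a ⊔ b = a * b / (a ⊓ b) := by
  rw [eq_div_iff_mul_eq', mul_comm (a ⊔ b), inf_mul_sup]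

end Inequalities

namespace LatticeSubgroup

variable {G : Type*} [CommGroup G] [Lattice G] [IsOrderedMonoid G]

/-- The property defining `truncationStable` passes from `a` and `b` to any element `h` of `H`
bounded by `|a|ₘ * |b|ₘ`. -/
theorem mem_of_mabs_le {H S : LatticeSubgroup G} {h a b : G} (hh : h ∈ H)
    (ha : ∀ y ∈ S, 1 ≤ y → ∀ n : ℕ, y ⊓ |a|ₘ ^ n ∈ H)
    (hb : ∀ y ∈ S, 1 ≤ y → ∀ n : ℕ, y ⊓ |b|ₘ ^ n ∈ H) (hle : |h|ₘ ≤ |a|ₘ * |b|ₘ) :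
    ∀ y ∈ S, 1 ≤ y → ∀ n : ℕ, y ⊓ |h|ₘ ^ n ∈ H := by
  let := CommGroup.toDistribLattice G
  intro y hy hy1 n
  have hle' : |h|ₘ ^ n ≤ |a|ₘ ^ (n * 2) ⊔ |b|ₘ ^ (n * 2) := by
    refine (pow_le_pow_left' hle n).trans ?_
    rw [mul_pow, pow_mul, pow_mul]
    exact mul_le_sq_sup_sq _ _
  have key : y ⊓ |h|ₘ ^ n =
      ((y ⊓ |a|ₘ ^ (n * 2)) ⊔ (y ⊓ |b|ₘ ^ (n * 2))) ⊓ |h|ₘ ^ n := by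
    have hd : (y ⊓ |a|ₘ ^ (n * 2)) ⊔ (y ⊓ |b|ₘ ^ (n * 2)) =
        y ⊓ (|a|ₘ ^ (n * 2) ⊔ |b|ₘ ^ (n * 2)) := (inf_sup_left (α := G) _ _ _).symm
    rw [hd, inf_assoc, inf_eq_right.2 hle']
  rw [key]
  exact H.inf_mem (H.sup_mem (ha y hy hy1 _) (hb y hy hy1 _)) (pow_mem (H.mabs_mem hh) n)

/-- The elements `h` of `H` all of whose truncations `y ⊓ |h|ⁿ` by positive elements `y` of `S`
remain in `H`. Powers are needed for closure under products, which rests on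
`|a|ⁿ * |b|ⁿ ≤ |a|²ⁿ ⊔ |b|²ⁿ`. -/
def truncationStable (H S : LatticeSubgroup G) : LatticeSubgroup G where
  carrier := {h | h ∈ H ∧ ∀ y ∈ S, 1 ≤ y → ∀ n : ℕ, y ⊓ |h|ₘ ^ n ∈ H}
  one_mem' := ⟨one_mem H, fun y _ hy n => by
    rw [mabs_one, one_pow, inf_eq_right.2 hy]; exact one_mem H⟩
  mul_mem' {a b} ha hb := by
    have hab := mul_mem ha.1 hb.1
    exact ⟨hab, mem_of_mabs_le hab ha.2 hb.2 (mabs_mul_le a b)⟩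
  inv_mem' {a} ha := ⟨inv_mem ha.1, by simpa only [mabs_inv] using ha.2⟩
  sup_mem' {a b} ha hb := by
    have hab := H.sup_mem ha.1 hb.1
    exact ⟨hab, mem_of_mabs_le hab ha.2 hb.2 (mabs_sup_le_mul a b)⟩

theorem inf_mem_truncationStable {H S : LatticeSubgroup G} {h y : G}
    (hh : h ∈ truncationStable H S) (hh1 : 1 ≤ h) (hy : y ∈ S) (hy1 : 1 ≤ y) :
    h ⊓ y ∈ truncationStable H S := by
  have hmem : h ⊓ y ∈ H := by
    have := hh.2 y hy hy1 1
    rwa [pow_one, mabs_of_one_le hh1, inf_comm] at this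
  refine ⟨hmem, mem_of_mabs_le hmem hh.2 hh.2 ?_⟩
  rw [mabs_of_one_le (le_inf hh1 hy1), mabs_of_one_le hh1]
  exact inf_le_left.trans (le_mul_of_one_le_left' hh1)

theorem exists_sup_eq_mul {H S : LatticeSubgroup G} {h y : G}
    (hh : h ∈ truncationStable H S) (hy : y ∈ S) :
    ∃ t ∈ truncationStable H S, ∃ z ∈ S, t * z = h ⊔ y := by
  set T := truncationStable H S
  have hp : h ⊔ 1 ∈ T := T.sup_mem hh (one_mem T)
  have hm : h⁻¹ ⊔ 1 ∈ T := T.sup_mem (inv_mem hh) (one_mem T)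
  have hyp : y ⊔ 1 ∈ S := S.sup_mem hy (one_mem S)
  have hym : y⁻¹ ⊔ 1 ∈ S := S.sup_mem (inv_mem hy) (one_mem S)
  have h₁ := inf_mem_truncationStable hp le_sup_right hyp le_sup_right
  have h₂ := inf_mem_truncationStable hm le_sup_right hym le_sup_right
  refine ⟨_, div_mem (div_mem hp h₁) h₂, _, hyp, ?_⟩
  rw [sup_eq_sup_div_inf h y, sup_eq_mul_div_inf (h ⊔ 1) (y ⊔ 1), div_mul_eq_mul_div,
    div_mul_eq_mul_div]

/-- The products `t * y` with `t` in `truncationStable H S` and `y` in `S`. Closure under joins is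
the reason for introducing truncations: translating, it reduces to joins `h ⊔ y`. The positive part
`h⁺ ⊔ y⁺ = h⁺ * y⁺ / (h⁺ ⊓ y⁺)` and the negative part `h⁻ ⊓ y⁻` of such a join involve only elements
of `truncationStable H S`, elements of `S`, and truncations of the former by the latter. -/
def truncationStableMul (H S : LatticeSubgroup G) : LatticeSubgroup G where
  carrier := {x | ∃ t ∈ truncationStable H S, ∃ y ∈ S, t * y = x}
  one_mem' := ⟨1, one_mem _, 1, one_mem _, one_mul 1⟩
  mul_mem' := by
    rintro _ _ ⟨t, ht, y, hy, rfl⟩ ⟨t', ht', y', hy', rfl⟩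
    exact ⟨t * t', mul_mem ht ht', y * y', mul_mem hy hy', mul_mul_mul_comm _ _ _ _⟩
  inv_mem' := by
    rintro _ ⟨t, ht, y, hy, rfl⟩
    exact ⟨t⁻¹, inv_mem ht, y⁻¹, inv_mem hy, (mul_inv t y).symm⟩
  sup_mem' := by
    rintro _ _ ⟨t, ht, y, hy, rfl⟩ ⟨t', ht', y', hy', rfl⟩
    obtain ⟨r, hr, z, hz, hrz⟩ := exists_sup_eq_mul (div_mem ht ht') (div_mem hy' hy)
    refine ⟨r * t', mul_mem hr ht', z * y, mul_mem hz hy, ?_⟩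
    rw [mul_mul_mul_comm, hrz, sup_mul]
    congr 1
    · rw [← mul_assoc, div_mul_cancel]
    · rw [mul_comm t' y, ← mul_assoc, div_mul_cancel, mul_comm]

end LatticeSubgroup

/-! ### Limits and isomorphisms in categories of points -/

namespace Pt

variable {C : Type u} [Category.{v} C]

theorem isIso_hom {Y : C} {A B : Pt Y} (h : A ⟶ B) [IsIso h] : IsIso h.hom :=
  ⟨(inv h).hom, by rw [← comp_hom, IsIso.hom_inv_id, id_hom],
    by rw [← comp_hom, IsIso.inv_hom_id, id_hom]⟩

theorem isIso_of_isIso_hom {Y : C} {A B : Pt Y} (h : A ⟶ B) [IsIso h.hom] : IsIso h :=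
  ⟨⟨inv h.hom, by rw [IsIso.inv_comp_eq, h.hom_proj], by rw [IsIso.comp_inv_eq, h.sec_hom]⟩,
    hom_ext (IsIso.hom_inv_id h.hom), hom_ext (IsIso.inv_hom_id h.hom)⟩

/-- The point over `Y` which is terminal, and initial as well. -/
@[simps]
def trivial (Y : C) : Pt Y := ⟨Y, 𝟙 Y, 𝟙 Y, Category.id_comp _⟩

/-- The inverse of an invertible projection is the section, so such a point is isomorphic to
`Pt.trivial Y`. -/
theorem isTerminal_of_isIso_proj {Y : C} (A : Pt Y) [IsIso A.proj] : Nonempty (IsTerminal A) :=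
  have hsec : A.sec = inv A.proj := IsIso.eq_inv_of_inv_hom_id A.sec_proj
  ⟨IsTerminal.ofUniqueHom
    (fun B => ⟨B.proj ≫ A.sec, by rw [Category.assoc, A.sec_proj, Category.comp_id], by
      rw [← Category.assoc, B.sec_proj, Category.id_comp]⟩)
    (fun B m => hom_ext (by
      change m.hom = B.proj ≫ A.sec
      rw [hsec, ← m.hom_proj, Category.assoc, IsIso.hom_inv_id, Category.comp_id]))⟩

theorem isIso_proj_of_isTerminal {Y : C} {A : Pt Y} (hA : IsTerminal A) : IsIso A.proj :=
  haveI : IsIso (trivial Y).proj := inferInstanceAs (IsIso (𝟙 Y))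
  let e := hA.uniqueUpToIso (isTerminal_of_isIso_proj (trivial Y)).some
  have he : e.hom.hom = A.proj := by
    rw [← e.hom.hom_proj]; exact (Category.comp_id _).symm
  he ▸ isIso_hom e.hom

instance (Y : C) : HasTerminal (Pt Y) :=
  haveI : IsIso (trivial Y).proj := inferInstanceAs (IsIso (𝟙 Y))
  (isTerminal_of_isIso_proj (trivial Y)).some.hasTerminal

theorem isPullback_of_isPullback_hom {Y : C} {P A B D : Pt Y} {p : P ⟶ A} {q : P ⟶ B} {g : A ⟶ D}
    {h : B ⟶ D} (H : IsPullback p.hom q.hom g.hom h.hom) : IsPullback p q g h := by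
  have w : p ≫ g = q ≫ h := hom_ext H.w
  refine ⟨⟨w⟩, ⟨PullbackCone.IsLimit.mk w (fun s => ?_) (fun s => ?_) (fun s => ?_)
    (fun s m h₁ h₂ => ?_)⟩⟩
  · refine ⟨H.lift s.fst.hom s.snd.hom (congrArg Hom.hom s.condition), ?_, ?_⟩
    · rw [← p.hom_proj, H.lift_fst_assoc, s.fst.hom_proj]
    · refine H.hom_ext ?_ ?_
      · rw [Category.assoc, H.lift_fst, s.fst.sec_hom, p.sec_hom]
      · rw [Category.assoc, H.lift_snd, s.snd.sec_hom, q.sec_hom]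
  · exact hom_ext (H.lift_fst _ _ _)
  · exact hom_ext (H.lift_snd _ _ _)
  · refine hom_ext (H.hom_ext ?_ ?_)
    · exact (congrArg Hom.hom h₁).trans (H.lift_fst _ _ _).symm
    · exact (congrArg Hom.hom h₂).trans (H.lift_snd _ _ _).symm

section Pullback

variable [HasPullbacks C]

/-- The pullback of points over `Y`, computed in the ambient category. -/
@[simps]
noncomputable def pullbackObj {Y : C} {A B D : Pt Y} (g : A ⟶ D) (h : B ⟶ D) : Pt Y where
  obj := pullback g.hom h.hom
  proj := pullback.fst g.hom h.hom ≫ A.proj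
  sec := pullback.lift A.sec B.sec (by rw [g.sec_hom, h.sec_hom])
  sec_proj := by rw [pullback.lift_fst_assoc, A.sec_proj]

/-- The first projection of the pullback of points. -/
@[simps]
noncomputable def pullbackFst {Y : C} {A B D : Pt Y} (g : A ⟶ D) (h : B ⟶ D) :
    pullbackObj g h ⟶ A :=
  ⟨pullback.fst g.hom h.hom, rfl, pullback.lift_fst _ _ _⟩

/-- The second projection of the pullback of points. -/
@[simps]
noncomputable def pullbackSnd {Y : C} {A B D : Pt Y} (g : A ⟶ D) (h : B ⟶ D) :
    pullbackObj g h ⟶ B :=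
  ⟨pullback.snd g.hom h.hom,
    show pullback.snd g.hom h.hom ≫ B.proj = pullback.fst g.hom h.hom ≫ A.proj by
      rw [← h.hom_proj, ← pullback.condition_assoc, g.hom_proj],
    pullback.lift_snd _ _ _⟩

theorem isPullback_pullbackObj {Y : C} {A B D : Pt Y} (g : A ⟶ D) (h : B ⟶ D) :
    IsPullback (pullbackFst g h) (pullbackSnd g h) g h :=
  isPullback_of_isPullback_hom (IsPullback.of_hasPullback g.hom h.hom)

instance (Y : C) : HasPullbacks (Pt Y) :=
  haveI : ∀ {A B D : Pt Y} {g : A ⟶ D} {h : B ⟶ D}, HasLimit (cospan g h) :=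
    fun {_ _ _ g h} => (isPullback_pullbackObj g h).hasPullback
  hasPullbacks_of_hasLimit_cospan _

theorem mono_hom {Y : C} {A B : Pt Y} (h : A ⟶ B) [Mono h] : Mono h.hom := by
  have e : pullbackFst h h = pullbackSnd h h := by
    rw [← cancel_mono h, (isPullback_pullbackObj h h).w]
  refine ⟨fun a b hab => ?_⟩
  exact (pullback.lift_fst a b hab).symm.trans
    ((congrArg (pullback.lift a b hab ≫ ·) (congrArg Hom.hom e)).trans (pullback.lift_snd a b hab))

theorem isPullback_pullbackMap {X Y : C} (f : X ⟶ Y) {P A B D : Pt Y} {p : P ⟶ A} {q : P ⟶ B}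
    {g : A ⟶ D} {h : B ⟶ D} (H : IsPullback p.hom q.hom g.hom h.hom) :
    IsPullback (pullbackMap f p) (pullbackMap f q) (pullbackMap f g) (pullbackMap f h) := by
  have w : pullbackMap f p ≫ pullbackMap f g = pullbackMap f q ≫ pullbackMap f h := by
    rw [← pullbackMap_comp, ← pullbackMap_comp]
    exact congrArg _ (hom_ext H.w)
  have hfst (s : PullbackCone (pullbackMap f g) (pullbackMap f h)) :
      (s.fst ≫ pullback.fst A.proj f) ≫ g.hom = (s.snd ≫ pullback.fst B.proj f) ≫ h.hom := by
    rw [Category.assoc, Category.assoc, ← pullbackMap_fst, ← pullbackMap_fst,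
      s.condition_assoc]
  have hsnd (s : PullbackCone (pullbackMap f g) (pullbackMap f h)) :
      s.fst ≫ pullback.snd A.proj f = s.snd ≫ pullback.snd B.proj f := by
    rw [← pullbackMap_snd f g, ← pullbackMap_snd f h, s.condition_assoc]
  refine ⟨⟨w⟩, ⟨PullbackCone.IsLimit.mk w
    (fun s => pullback.lift (H.lift _ _ (hfst s)) (s.fst ≫ pullback.snd A.proj f) ?_)
    (fun s => ?_) (fun s => ?_) (fun s m h₁ h₂ => ?_)⟩⟩
  · rw [← p.hom_proj, H.lift_fst_assoc, Category.assoc, Category.assoc, pullback.condition]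
  · apply pullback.hom_ext
    · rw [Category.assoc, pullbackMap_fst, pullback.lift_fst_assoc, H.lift_fst]
    · rw [Category.assoc, pullbackMap_snd, pullback.lift_snd]
  · apply pullback.hom_ext
    · rw [Category.assoc, pullbackMap_fst, pullback.lift_fst_assoc, H.lift_snd]
    · rw [Category.assoc, pullbackMap_snd, pullback.lift_snd, hsnd]
  · apply pullback.hom_ext
    · rw [pullback.lift_fst]
      refine H.hom_ext ?_ ?_
      · rw [H.lift_fst, Category.assoc, ← pullbackMap_fst, ← h₁, Category.assoc]
      · rw [H.lift_snd, Category.assoc, ← pullbackMap_fst, ← h₂, Category.assoc]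
    · rw [pullback.lift_snd, ← h₁, Category.assoc, pullbackMap_snd]

theorem isPullback_changeOfBase_map {X Y : C} (f : X ⟶ Y) {A B D : Pt Y} (g : A ⟶ D)
    (h : B ⟶ D) :
    IsPullback ((changeOfBase f).map (pullbackFst g h)) ((changeOfBase f).map (pullbackSnd g h))
      ((changeOfBase f).map g) ((changeOfBase f).map h) :=
  isPullback_of_isPullback_hom (isPullback_pullbackMap f (p := pullbackFst g h)
    (q := pullbackSnd g h) (IsPullback.of_hasPullback g.hom h.hom))

/-- Change of base preserves finite limits in any category with pullbacks: the terminal points are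
those with invertible projection, and pullbacks of points are pullbacks in the ambient category. -/
theorem preservesFiniteLimits_changeOfBase {X Y : C} (f : X ⟶ Y) :
    PreservesFiniteLimits (changeOfBase f) := by
  have : PreservesLimitsOfShape (Discrete PEmpty.{1}) (changeOfBase f) := by
    have : IsIso (⊤_ (Pt Y)).proj := isIso_proj_of_isTerminal terminalIsTerminal
    have : IsIso ((changeOfBase f).obj (⊤_ (Pt Y))).proj :=
      inferInstanceAs (IsIso (pullback.snd (⊤_ (Pt Y)).proj f))
    have := preservesTerminal_of_iso (changeOfBase f)
      ((isTerminal_of_isIso_proj _).some.uniqueUpToIso terminalIsTerminal)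
    exact preservesLimitsOfShape_pempty_of_preservesTerminal _
  have : PreservesLimitsOfShape WalkingCospan (changeOfBase f) := by
    refine ⟨fun {K} => ?_⟩
    have : PreservesLimit (cospan (K.map WalkingCospan.Hom.inl) (K.map WalkingCospan.Hom.inr))
        (changeOfBase f) := by
      have H := isPullback_pullbackObj (K.map WalkingCospan.Hom.inl) (K.map WalkingCospan.Hom.inr)
      refine preservesLimit_of_preserves_limit_cone H.isLimit
        ((isLimitMapConePullbackConeEquiv _ H.w).symm ?_)
      exact (isPullback_changeOfBase_map f _ _).isLimit
    exact preservesLimit_of_iso_diagram _ (diagramIsoCospan K).symm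
  exact preservesFiniteLimits_of_preservesTerminal_and_pullbacks _

end Pullback

end Pt

/-! ### Finite limits of lattice-ordered abelian groups -/

namespace LAb

instance (A B : LAb.{u}) : MonoidHomClass (Hom A B) A B where
  map_mul f := f.toMonoidHom.map_mul
  map_one f := f.toMonoidHom.map_one

theorem map_sup {A B : LAb.{u}} (f : A ⟶ B) (x y : A) : f (x ⊔ y) = f x ⊔ f y :=
  Hom.map_sup' f x y

theorem map_inf {A B : LAb.{u}} (f : A ⟶ B) (x y : A) : f (x ⊓ y) = f x ⊓ f y := by
  rw [← inv_inv (x ⊓ y), inv_inf, map_inv, map_sup, map_inv, map_inv, inv_sup, inv_inv, inv_inv]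

theorem map_mabs {A B : LAb.{u}} (f : A ⟶ B) (x : A) : f |x|ₘ = |f x|ₘ := by
  rw [mabs, mabs, map_sup, map_inv]

theorem map_mono {A B : LAb.{u}} (f : A ⟶ B) {x y : A} (h : x ≤ y) : f x ≤ f y := by
  rw [← sup_eq_right, ← map_sup, sup_eq_right.2 h]

theorem hom_ext {A B : LAb.{u}} {f g : A ⟶ B} (h : ∀ x : A, f x = g x) : f = g :=
  ConcreteCategory.hom_ext f g h

/-- An injective morphism through whose range `f` factors pointwise yields a factorisation of `f`
by a morphism. -/
theorem exists_lift {A B D : LAb.{u}} (i : A ⟶ B) (hi : Function.Injective i) (f : D ⟶ B)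
    (h : ∀ d : D, ∃ a : A, i a = f d) : ∃ l : D ⟶ A, l ≫ i = f := by
  choose l hl using h
  refine ⟨(⟨⟨⟨l, hi ?_⟩, fun x y => hi ?_⟩, fun x y => hi ?_⟩ : Hom D A), hom_ext hl⟩
  · rw [hl, map_one, map_one]
  · rw [map_mul, hl, map_mul]
    exact congrArg₂ _ (hl x).symm (hl y).symm
  · change i (l (x ⊔ y)) = i (l x ⊔ l y)
    rw [map_sup, hl, hl, hl, map_sup]

theorem isIso_of_bijective {A B : LAb.{u}} (f : A ⟶ B) (hf : Function.Bijective f) : IsIso f := by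
  obtain ⟨g, hg⟩ := exists_lift f hf.1 (𝟙 B) hf.2
  refine ⟨g, hom_ext fun x => hf.1 ?_, hg⟩
  exact congrArg (fun k : B ⟶ B => k (f x)) hg

theorem bijective_of_isIso {A B : LAb.{u}} (f : A ⟶ B) [IsIso f] : Function.Bijective f :=
  ⟨fun x y h => by
    have := congrArg (inv f) h
    rwa [← ConcreteCategory.comp_apply, ← ConcreteCategory.comp_apply, IsIso.hom_inv_id] at this,
  fun y => ⟨inv f y, by
    rw [← ConcreteCategory.comp_apply, IsIso.inv_hom_id]; rfl⟩⟩

/-- The lattice-ordered abelian group underlying an `ℓ`-subgroup. -/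
def ofSubgroup {A : LAb.{u}} (S : LatticeSubgroup A) : LAb.{u} :=
  letI : Lattice S := Subtype.lattice (fun _ _ => S.sup_mem) (fun _ _ => S.inf_mem)
  haveI : IsOrderedMonoid S := ⟨fun _ _ h c => mul_le_mul_left (α := A) h c,
    fun _ _ h c => mul_le_mul_right (α := A) h c⟩
  ⟨S⟩

/-- The inclusion of an `ℓ`-subgroup. -/
def incl {A : LAb.{u}} (S : LatticeSubgroup A) : ofSubgroup S ⟶ A :=
  (⟨SubgroupClass.subtype S, fun _ _ => rfl⟩ : Hom (ofSubgroup S) A)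

theorem incl_injective {A : LAb.{u}} (S : LatticeSubgroup A) : Function.Injective (incl S) :=
  Subtype.val_injective

theorem exists_incl_eq {A : LAb.{u}} {S : LatticeSubgroup A} {x : A} (hx : x ∈ S) :
    ∃ y, incl S y = x := ⟨⟨x, hx⟩, rfl⟩

theorem incl_mem {A : LAb.{u}} {S : LatticeSubgroup A} (y : ofSubgroup S) : incl S y ∈ S :=
  Subtype.property (p := (· ∈ S)) y

/-- The range of a morphism. -/
def range {A B : LAb.{u}} (f : A ⟶ B) : LatticeSubgroup B where
  carrier := Set.range f
  one_mem' := ⟨1, map_one (ConcreteCategory.hom f)⟩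
  mul_mem' := by rintro _ _ ⟨x, rfl⟩ ⟨y, rfl⟩; exact ⟨x * y, map_mul (ConcreteCategory.hom f) x y⟩
  inv_mem' := by rintro _ ⟨x, rfl⟩; exact ⟨x⁻¹, map_inv (ConcreteCategory.hom f) x⟩
  sup_mem' := by rintro _ _ ⟨x, rfl⟩ ⟨y, rfl⟩; exact ⟨x ⊔ y, map_sup f x y⟩

/-- The product of two lattice-ordered abelian groups, ordered componentwise. -/
def prod (A B : LAb.{u}) : LAb.{u} := ⟨A × B⟩

/-- The pullback of `f` and `g` as a subset of the product. -/
def fiberProduct {A B D : LAb.{u}} (f : A ⟶ D) (g : B ⟶ D) : LatticeSubgroup (prod A B) where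
  carrier := {x : A × B | f x.1 = g x.2}
  one_mem' := (map_one (ConcreteCategory.hom f)).trans (map_one (ConcreteCategory.hom g)).symm
  mul_mem' {x y} hx hy := (map_mul (ConcreteCategory.hom f) x.1 y.1).trans
    ((congrArg₂ _ hx hy).trans (map_mul (ConcreteCategory.hom g) x.2 y.2).symm)
  inv_mem' {x} hx := (map_inv (ConcreteCategory.hom f) x.1).trans
    ((congrArg _ hx).trans (map_inv (ConcreteCategory.hom g) x.2).symm)
  sup_mem' {x y} hx hy :=
    (map_sup f x.1 y.1).trans ((congrArg₂ _ hx hy).trans (map_sup g x.2 y.2).symm)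

/-- The first projection of a product. -/
def fst (A B : LAb.{u}) : prod A B ⟶ A := (⟨MonoidHom.fst A B, fun _ _ => rfl⟩ : Hom (prod A B) A)

/-- The second projection of a product. -/
def snd (A B : LAb.{u}) : prod A B ⟶ B := (⟨MonoidHom.snd A B, fun _ _ => rfl⟩ : Hom (prod A B) B)

/-- The morphism into a product with the given components. -/
def prodLift {A B D : LAb.{u}} (f : D ⟶ A) (g : D ⟶ B) : D ⟶ prod A B :=
  (⟨MonoidHom.prod (Hom.toMonoidHom f) (Hom.toMonoidHom g),
    fun x y => Prod.ext (map_sup f x y) (map_sup g x y)⟩ : Hom D (prod A B))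

theorem isPullback_fiberProduct {A B D : LAb.{u}} (f : A ⟶ D) (g : B ⟶ D) :
    IsPullback (incl (fiberProduct f g) ≫ fst A B) (incl (fiberProduct f g) ≫ snd A B) f g := by
  have w : (incl (fiberProduct f g) ≫ fst A B) ≫ f = (incl (fiberProduct f g) ≫ snd A B) ≫ g :=
    hom_ext fun x => incl_mem x
  refine ⟨⟨w⟩, ⟨PullbackCone.isLimitAux' _ fun s => ?_⟩⟩
  have hl := exists_lift (incl (fiberProduct f g)) (incl_injective _) (prodLift s.fst s.snd)
    fun d => exists_incl_eq (congrArg (fun k : s.pt ⟶ D => k d) s.condition)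
  refine ⟨hl.choose, ?_, ?_, fun {m} h₁ h₂ => hom_ext fun x => incl_injective _ ?_⟩
  · exact congrArg (· ≫ fst A B) hl.choose_spec
  · exact congrArg (· ≫ snd A B) hl.choose_spec
  · refine Eq.trans ?_ (congrArg (fun k : s.pt ⟶ prod A B => k x) hl.choose_spec).symm
    exact Prod.ext (congrArg (fun k : s.pt ⟶ A => k x) h₁) (congrArg (fun k : s.pt ⟶ B => k x) h₂)

instance : HasPullbacks LAb.{u} :=
  have : ∀ {A B D : LAb.{u}} {f : A ⟶ D} {g : B ⟶ D}, HasLimit (cospan f g) :=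
    fun {_ _ _ f g} => (isPullback_fiberProduct f g).hasPullback
  hasPullbacks_of_hasLimit_cospan _

instance : HasZeroObject LAb.{u} :=
  have : IsOrderedMonoid PUnit.{u + 1} := ⟨fun _ _ h _ => h, fun _ _ h _ => h⟩
  ⟨⟨⟨PUnit⟩, fun _ => ⟨⟨⟨0⟩, fun f => hom_ext fun x => by
      obtain rfl : x = 1 := rfl
      rw [map_one, map_one]⟩⟩,
    fun _ => ⟨⟨⟨0⟩, fun _ => hom_ext fun _ => rfl⟩⟩⟩⟩

instance : HasFiniteLimits LAb.{u} :=
  have : HasTerminal LAb.{u} := HasZeroObject.hasTerminal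
  hasFiniteLimits_of_hasTerminal_and_pullbacks

theorem exists_pullback_eq {A B D : LAb.{u}} {f : A ⟶ D} {g : B ⟶ D} {a : A} {b : B}
    (h : f a = g b) :
    ∃ z : (pullback f g : LAb.{u}), pullback.fst f g z = a ∧ pullback.snd f g z = b := by
  obtain ⟨z, hz⟩ := exists_incl_eq (S := fiberProduct f g) (x := ((a, b) : A × B)) h
  have H := isPullback_fiberProduct f g
  refine ⟨pullback.lift _ _ H.w z, ?_, ?_⟩
  · rw [← ConcreteCategory.comp_apply, pullback.lift_fst]
    exact congrArg Prod.fst hz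
  · rw [← ConcreteCategory.comp_apply, pullback.lift_snd]
    exact congrArg Prod.snd hz

theorem pullback_ext {A B D : LAb.{u}} {f : A ⟶ D} {g : B ⟶ D} {z z' : (pullback f g : LAb.{u})}
    (h₁ : pullback.fst f g z = pullback.fst f g z')
    (h₂ : pullback.snd f g z = pullback.snd f g z') : z = z' := by
  have H := isPullback_fiberProduct f g
  let e := H.isoPullback.symm
  refine (bijective_of_isIso e.hom).1 (incl_injective _ (Prod.ext ?_ ?_))
  · change (e.hom ≫ incl (fiberProduct f g) ≫ fst A B) z =
      (e.hom ≫ incl (fiberProduct f g) ≫ fst A B) z'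
    rwa [Iso.symm_hom, H.isoPullback_inv_fst]
  · change (e.hom ≫ incl (fiberProduct f g) ≫ snd A B) z =
      (e.hom ≫ incl (fiberProduct f g) ≫ snd A B) z'
    rwa [Iso.symm_hom, H.isoPullback_inv_snd]

theorem injective_of_mono {A B : LAb.{u}} (f : A ⟶ B) [Mono f] : Function.Injective f := by
  intro x y h
  obtain ⟨z, hx, hy⟩ := exists_pullback_eq h
  rw [← hx, ← hy, (cancel_mono f).1 (pullback.condition (f := f) (g := f))]

theorem mono_of_injective {A B : LAb.{u}} (f : A ⟶ B) (hf : Function.Injective f) : Mono f :=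
  ConcreteCategory.mono_of_injective f hf

/-! ### Protomodularity -/

theorem proj_sec {Y : LAb.{u}} (A : Pt Y) (y : Y) : A.proj (A.sec y) = y :=
  congrArg (fun k : Y ⟶ Y => k y) A.sec_proj

theorem proj_hom {Y : LAb.{u}} {A B : Pt Y} (g : A ⟶ B) (a : A.obj) :
    B.proj (g.hom a) = A.proj a :=
  congrArg (fun k : A.obj ⟶ Y => k a) g.hom_proj

theorem hom_sec {Y : LAb.{u}} {A B : Pt Y} (g : A ⟶ B) (y : Y) : g.hom (A.sec y) = B.sec y :=
  congrArg (fun k : Y ⟶ B.obj => k y) g.sec_hom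

theorem fst_pullbackMap {X Y : LAb.{u}} (f : X ⟶ Y) {A B : Pt Y} (g : A ⟶ B)
    (z : (pullback A.proj f : LAb.{u})) :
    pullback.fst B.proj f (Pt.pullbackMap f g z) = g.hom (pullback.fst A.proj f z) :=
  congrArg (fun k : pullback A.proj f ⟶ B.obj => k z) (Pt.pullbackMap_fst f g)

theorem snd_pullbackMap {X Y : LAb.{u}} (f : X ⟶ Y) {A B : Pt Y} (g : A ⟶ B)
    (z : (pullback A.proj f : LAb.{u})) :
    pullback.snd B.proj f (Pt.pullbackMap f g z) = pullback.snd A.proj f z :=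
  congrArg (fun k : pullback A.proj f ⟶ X => k z) (Pt.pullbackMap_snd f g)

/-- A morphism of points is bijective as soon as its pullback along some `f` is, since the pullback
contains the kernel of the projection and every `b` differs from `B.sec (B.proj b)` by an element
of that kernel. -/
theorem reflectsIsomorphisms_changeOfBase {X Y : LAb.{u}} (f : X ⟶ Y) :
    (Pt.changeOfBase f).ReflectsIsomorphisms where
  reflects {A B} g _ := by
    have : IsIso (Pt.pullbackMap f g) := Pt.isIso_hom ((Pt.changeOfBase f).map g)
    have hb := bijective_of_isIso (Pt.pullbackMap f g)
    have : IsIso g.hom := by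
      refine isIso_of_bijective _
        ⟨(injective_iff_map_eq_one (ConcreteCategory.hom g.hom)).2 fun a ha => ?_, fun b => ?_⟩
      · have hp : A.proj a = f 1 := by rw [← proj_hom g, ha, map_one, map_one]
        obtain ⟨z, hz₁, hz₂⟩ := exists_pullback_eq hp
        have hz : z = 1 :=
          (injective_iff_map_eq_one (ConcreteCategory.hom (Pt.pullbackMap f g))).1 hb.1 z
          (pullback_ext (by rw [fst_pullbackMap, hz₁, ha, map_one])
            (by rw [snd_pullbackMap, hz₂, map_one]))
        rw [← hz₁, hz, map_one]
      · have hp : B.proj (b / B.sec (B.proj b)) = f 1 := by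
          rw [map_div, proj_sec, div_self', map_one]
        obtain ⟨z, hz₁, -⟩ := exists_pullback_eq hp
        obtain ⟨w, hw⟩ := hb.2 z
        refine ⟨pullback.fst A.proj f w * A.sec (B.proj b), ?_⟩
        rw [map_mul, hom_sec, ← fst_pullbackMap, hw, hz₁, div_mul_cancel]
    exact Pt.isIso_of_isIso_hom g

/-! ### Jointly extremally epimorphic pairs -/

/-- For a point `B` over `Y` and a morphism `m` into its pullback along some `X ⟶ Y`, the elements
`k` of the kernel of `B.proj` such that `(k, 1)` is in the range of `m`. -/
noncomputable def kernelPart {X Y : LAb.{u}} {f : X ⟶ Y} {B : Pt Y} {M : LAb.{u}}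
    (m : M ⟶ pullback B.proj f) : LatticeSubgroup B.obj where
  carrier := {k | ∃ z : M, pullback.fst B.proj f (m z) = k ∧ pullback.snd B.proj f (m z) = 1}
  one_mem' := ⟨1, by rw [map_one, map_one], by rw [map_one, map_one]⟩
  mul_mem' := by
    rintro _ _ ⟨z, rfl, h⟩ ⟨w, rfl, h'⟩
    exact ⟨z * w, by rw [map_mul, map_mul], by rw [map_mul, map_mul, h, h', one_mul]⟩
  inv_mem' := by
    rintro _ ⟨z, rfl, h⟩
    exact ⟨z⁻¹, by rw [map_inv, map_inv], by rw [map_inv, map_inv, h, inv_one]⟩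
  sup_mem' := by
    rintro _ _ ⟨z, rfl, h⟩ ⟨w, rfl, h'⟩
    exact ⟨z ⊔ w, by rw [map_sup, map_sup], by rw [map_sup, map_sup, h, h', sup_idem]⟩

theorem proj_of_mem_kernelPart {X Y : LAb.{u}} {f : X ⟶ Y} {B : Pt Y} {M : LAb.{u}}
    {m : M ⟶ pullback B.proj f} {k : B.obj} (hk : k ∈ kernelPart m) : B.proj k = 1 := by
  obtain ⟨z, rfl, h⟩ := hk
  rw [← ConcreteCategory.comp_apply, pullback.condition, ConcreteCategory.comp_apply, h, map_one]

/-- If the pullback of `g` factors through `m`, then the range of `g` consists of products of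
truncation-stable elements of `kernelPart m` and elements of the section: the kernel of `A.proj` is
mapped into `kernelPart m` and is closed under truncation by positive elements of the section. -/
theorem hom_mem_truncationStableMul {X Y : LAb.{u}} {f : X ⟶ Y} {A B : Pt Y} (g : A ⟶ B)
    {M : LAb.{u}} {m : M ⟶ pullback B.proj f} {l : pullback A.proj f ⟶ M}
    (h : l ≫ m = Pt.pullbackMap f g) (a : A.obj) :
    g.hom a ∈ (kernelPart m).truncationStableMul (range B.sec) := by
  have key (k : A.obj) (hk : A.proj k = 1) : g.hom k ∈ kernelPart m := by
    obtain ⟨z, hz₁, hz₂⟩ := exists_pullback_eq (hk.trans (map_one (ConcreteCategory.hom f)).symm)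
    have hz : m (l z) = Pt.pullbackMap f g z :=
      congrArg (fun k : pullback A.proj f ⟶ pullback B.proj f => k z) h
    exact ⟨l z, by rw [hz, fst_pullbackMap, hz₁], by rw [hz, snd_pullbackMap, hz₂]⟩
  have hk : A.proj (a / A.sec (A.proj a)) = 1 := by rw [map_div, proj_sec, div_self']
  refine ⟨g.hom (a / A.sec (A.proj a)), ⟨key _ hk, ?_⟩, B.sec (A.proj a), ⟨_, rfl⟩, ?_⟩
  · rintro _ ⟨y, rfl⟩ hy n
    have hy1 : 1 ≤ y := by simpa only [proj_sec, map_one] using map_mono B.proj hy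
    rw [← map_mabs, ← map_pow, ← hom_sec g, ← map_inf]
    refine key _ ?_
    rw [map_inf, proj_sec, map_pow, map_mabs, hk, mabs_one, one_pow, inf_eq_right.2 hy1]
  · rw [← hom_sec g, ← map_mul, div_mul_cancel]

/-- An `ℓ`-subgroup of a point which contains the section is itself a point. -/
noncomputable def subPt {Y : LAb.{u}} (B : Pt Y) (S : LatticeSubgroup B.obj)
    (hS : ∀ y, B.sec y ∈ S) : Pt Y where
  obj := ofSubgroup S
  proj := incl S ≫ B.proj
  sec := (exists_lift (incl S) (incl_injective S) B.sec fun y => exists_incl_eq (hS y)).choose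
  sec_proj := by
    rw [← Category.assoc, Exists.choose_spec
      (exists_lift (incl S) (incl_injective S) B.sec fun y => exists_incl_eq (hS y)), B.sec_proj]

/-- The inclusion of an `ℓ`-subgroup as a morphism of points. -/
noncomputable def subPtIncl {Y : LAb.{u}} (B : Pt Y) (S : LatticeSubgroup B.obj)
    (hS : ∀ y, B.sec y ∈ S) :
    subPt B S hS ⟶ B :=
  ⟨incl S, rfl, Exists.choose_spec
    (exists_lift (incl S) (incl_injective S) B.sec fun y => exists_incl_eq (hS y))⟩

theorem exists_comp_subPtIncl {Y : LAb.{u}} {A B : Pt Y} (g : A ⟶ B) (S : LatticeSubgroup B.obj)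
    (hS : ∀ y, B.sec y ∈ S) (h : ∀ a, g.hom a ∈ S) :
    ∃ l : A ⟶ subPt B S hS, l ≫ subPtIncl B S hS = g := by
  obtain ⟨l, hl⟩ := exists_lift (incl S) (incl_injective S) g.hom fun a => exists_incl_eq (h a)
  refine ⟨⟨l, ?_, hom_ext fun y => incl_injective S ?_⟩, Pt.hom_ext hl⟩
  · change l ≫ incl S ≫ B.proj = A.proj
    rw [← Category.assoc, hl, g.hom_proj]
  · have h₁ : incl S (l (A.sec y)) = g.hom (A.sec y) :=
      congrArg (fun k : A.obj ⟶ B.obj => k (A.sec y)) hl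
    have h₂ : incl S ((subPt B S hS).sec y) = B.sec y := hom_sec (subPtIncl B S hS) y
    exact h₁.trans ((hom_sec g y).trans h₂.symm)

/-- A jointly extremally epimorphic pair of morphisms of points jointly generates: an `ℓ`-subgroup
that contains both ranges is everything. -/
theorem mem_of_jointlyExtremallyEpi {Y : LAb.{u}} {A A' B : Pt Y} {g : A ⟶ B} {g' : A' ⟶ B}
    (H : JointlyExtremallyEpi g g') (S : LatticeSubgroup B.obj) (h : ∀ a, g.hom a ∈ S)
    (h' : ∀ a, g'.hom a ∈ S) (b : B.obj) : b ∈ S := by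
  have hS (y : Y) : B.sec y ∈ S := hom_sec g y ▸ h (A.sec y)
  obtain ⟨l, hl⟩ := exists_comp_subPtIncl g S hS h
  obtain ⟨l', hl'⟩ := exists_comp_subPtIncl g' S hS h'
  have hm : Mono (subPtIncl B S hS) := ⟨fun p q hpq => Pt.hom_ext (hom_ext fun x =>
    incl_injective S (congrArg (fun k : _ ⟶ B => k.hom x) hpq))⟩
  have := H (subPtIncl B S hS) l l' hm hl hl'
  have : IsIso (incl S) := Pt.isIso_hom (subPtIncl B S hS)
  obtain ⟨z, rfl⟩ := (bijective_of_isIso (incl S)).2 b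
  exact incl_mem z

theorem jointlyExtremallyEpi_changeOfBase {X Y : LAb.{u}} (f : X ⟶ Y) {A A' B : Pt Y} {g : A ⟶ B}
    {g' : A' ⟶ B} (H : JointlyExtremallyEpi g g') :
    JointlyExtremallyEpi ((Pt.changeOfBase f).map g) ((Pt.changeOfBase f).map g') := by
  intro M m l l' hm hl hl'
  let m₀ : M.obj ⟶ pullback B.proj f := m.hom
  have : Mono m₀ := Pt.mono_hom m
  have hgen := mem_of_jointlyExtremallyEpi H ((kernelPart m₀).truncationStableMul (range B.sec))
    (hom_mem_truncationStableMul g (congrArg Pt.Hom.hom hl))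
    (hom_mem_truncationStableMul g' (congrArg Pt.Hom.hom hl'))
  -- The truncation-stable part lies in the kernel, so it is all of the kernel.
  have hker (k : B.obj) (hk : B.proj k = 1) : k ∈ kernelPart m₀ := by
    obtain ⟨t, ht, _, ⟨y, rfl⟩, rfl⟩ := hgen k
    rw [map_mul, proj_of_mem_kernelPart ht.1, proj_sec, one_mul] at hk
    rw [hk, map_one, mul_one]
    exact ht.1
  have : IsIso m₀ := by
    refine isIso_of_bijective m₀ ⟨injective_of_mono m₀, fun w => ?_⟩
    let σ : (pullback B.proj f : LAb.{u}) := (Pt.changeOfBaseObj f B).sec (pullback.snd B.proj f w)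
    have hσ : pullback.snd B.proj f σ = pullback.snd B.proj f w :=
      proj_sec (Pt.changeOfBaseObj f B) _
    have hw : B.proj (pullback.fst B.proj f (w / σ)) = 1 := by
      rw [← ConcreteCategory.comp_apply, pullback.condition, ConcreteCategory.comp_apply, map_div,
        hσ, div_self', map_one]
    obtain ⟨z, hz₁, hz₂⟩ := hker _ hw
    have hz : m₀ z = w / σ := pullback_ext hz₁ (by rw [hz₂, map_div, hσ, div_self'])
    refine ⟨z * M.sec (pullback.snd B.proj f w), ?_⟩
    rw [map_mul, hz]
    exact (congrArg _ (hom_sec m _)).trans (div_mul_cancel w σ)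
  have : IsIso m.hom := this
  exact Pt.isIso_of_isIso_hom m

/-! ### Failure of action accessibility -/

/-- A linearly ordered abelian group as an object of `LAb`, transported to an arbitrary universe by
taking functions on a one-point type. -/
def ofLinear (G : Type) [CommGroup G] [LinearOrder G] [IsOrderedMonoid G] : LAb.{u} :=
  ⟨PUnit.{u + 1} → G⟩

/-- The morphism induced by a monotone homomorphism of linearly ordered groups. -/
def ofLinearMap {G H : Type} [CommGroup G] [LinearOrder G] [IsOrderedMonoid G] [CommGroup H]
    [LinearOrder H] [IsOrderedMonoid H] (φ : G →*o H) : ofLinear.{u} G ⟶ ofLinear.{u} H :=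
  (⟨φ.toMonoidHom.compLeft PUnit, fun x y => funext fun i => φ.monotone'.map_sup (x i) (y i)⟩ :
    Hom (ofLinear.{u} G) (ofLinear.{u} H))

/-- An injective morphism whose range is the kernel of `p` is a kernel of `p`. -/
theorem nonempty_isLimit_kernelFork {X A B : LAb.{u}} (k : X ⟶ A) (p : A ⟶ B) (w : k ≫ p = 0)
    (hk : Function.Injective k) (h : ∀ a, p a = 1 → ∃ x, k x = a) :
    Nonempty (IsLimit (KernelFork.ofι k w)) := by
  have : Mono k := mono_of_injective k hk
  refine ⟨KernelFork.IsLimit.ofι' k w fun {D} f hf => ?_⟩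
  have hl := exists_lift k hk f fun d => h _ (congrArg (fun t : D ⟶ B => t d) hf)
  exact ⟨hl.choose, hl.choose_spec⟩

open OrderMonoidHom

/-- The infinite cyclic group with its usual order, written multiplicatively. -/
abbrev Cyc : Type := Multiplicative ℤ

/-- The lexicographic product `Cyc ×ₗ Cyc`, as a split extension of its first factor by its second:
the kernel is infinitesimal with respect to the image of the section. -/
noncomputable def lexSplExt : SplExt (ofLinear.{u} Cyc) where
  A := ofLinear (Cyc ×ₗ Cyc)
  B := ofLinear Cyc
  k := ofLinearMap (inrₗ Cyc Cyc)
  p := ofLinearMap (fstₗ Cyc Cyc)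
  s := ofLinearMap (inlₗ Cyc Cyc)
  s_p := rfl
  k_p := rfl
  isKernel := by
    refine nonempty_isLimit_kernelFork _ _ _ (fun x y h => funext fun i => ?_) fun a ha => ?_
    · exact congrArg Prod.snd (congrFun h i)
    · refine ⟨fun i => (ofLex (a i)).2, funext fun i => Prod.ext ?_ rfl⟩
      exact (congrFun ha i).symm

/-- Squaring the first coordinate of the lexicographic product. -/
def sqFst : Cyc ×ₗ Cyc →*o Cyc ×ₗ Cyc where
  toFun x := toLex ((ofLex x).1 ^ 2, (ofLex x).2)
  map_one' := rfl
  map_mul' x y := Prod.ext (mul_pow _ _ 2) rfl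
  monotone' x y h := by
    rw [Prod.Lex.le_iff] at h
    rw [Prod.Lex.toLex_le_toLex]
    rcases h with h | ⟨h, h'⟩
    · exact Or.inl (pow_lt_pow_left' two_ne_zero h)
    · exact Or.inr ⟨congrArg (· ^ 2) h, h'⟩

/-- Squaring as a monotone endomorphism. -/
def sq : Cyc →*o Cyc := ⟨powMonoidHom 2, fun _ _ h => pow_le_pow_left' h 2⟩

/-- Squaring the complement of the kernel is an endomorphism of the split extension which is
different from the identity. -/
noncomputable def lexSplExtSq : lexSplExt.{u} ⟶ lexSplExt :=
  (⟨ofLinearMap sqFst, ofLinearMap sq, rfl, rfl, rfl⟩ : SplExt.Hom lexSplExt.{u} lexSplExt)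

theorem inrₗ_le_inlₗ_ofAdd_one (x : Cyc) :
    inrₗ Cyc Cyc x ≤ inlₗ Cyc Cyc (Multiplicative.ofAdd 1) :=
  Prod.Lex.toLex_le_toLex.2 (Or.inl (show (1 : Cyc) < Multiplicative.ofAdd 1 by decide))

/-- A morphism from `lexSplExt` to a faithful split extension identifies each element of the
quotient with its square, hence kills the section, hence by convexity the kernel. -/
theorem not_isAccessible_lexSplExt : ¬ lexSplExt.{u}.IsAccessible := by
  rintro ⟨F, hF, ⟨h⟩⟩
  let h₁ : lexSplExt.{u}.A ⟶ F.A := h.g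
  let h₂ : ofLinear.{u} Cyc ⟶ F.B := h.f
  have hf : ofLinearMap sq ≫ h₂ = h₂ := congrArg SplExt.Hom.f (hF _ (lexSplExtSq ≫ h) h)
  have hB (b : ofLinear.{u} Cyc) : h₂ b = 1 := by
    have hb : h₂ (b ^ 2) = h₂ b := congrArg (fun t : ofLinear.{u} Cyc ⟶ F.B => t b) hf
    rw [map_pow, pow_two] at hb
    exact mul_eq_left.1 hb
  let c : ofLinear.{u} Cyc := fun _ : PUnit => Multiplicative.ofAdd 1
  have hs : h₁ (lexSplExt.s c) = 1 := by
    have : h₁ (lexSplExt.s c) = F.s (h₂ c) :=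
      congrArg (fun t : ofLinear.{u} Cyc ⟶ F.A => t c) h.s_g
    rw [this, hB, map_one]
  have hle (x : ofLinear.{u} Cyc) : h₁ (lexSplExt.k x) ≤ 1 := by
    rw [← hs]
    exact map_mono h₁ fun i => inrₗ_le_inlₗ_ofAdd_one (x i)
  have hk : F.k = 0 := by
    rw [← h.k_g]
    refine hom_ext fun x => le_antisymm (hle x) ?_
    have := hle x⁻¹
    rwa [map_inv, map_inv, inv_le_one'] at this
  obtain ⟨hlim⟩ := F.isKernel
  have hid : 𝟙 (ofLinear.{u} Cyc) = 0 := by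
    refine Fork.IsLimit.hom_ext hlim ?_
    change 𝟙 _ ≫ F.k = 0 ≫ F.k
    rw [hk, comp_zero, comp_zero]
  have hc : c = 1 := congrArg (fun t : ofLinear.{u} Cyc ⟶ ofLinear.{u} Cyc => t c) hid
  have hc' : (Multiplicative.ofAdd 1 : Cyc) = 1 := congrFun hc PUnit.unit
  exact absurd hc' (by decide)

end LAb

theorem mainTheorem3 :
    IsAlgebraicallyCoherent LAb.{u} ∧ IsPointedProtomodular LAb.{u} ∧
      ¬ IsActionAccessible LAb.{u} := by
  refine ⟨⟨inferInstance, fun f => ⟨Pt.preservesFiniteLimits_changeOfBase f, fun _ _ h =>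
      LAb.jointlyExtremallyEpi_changeOfBase f h⟩⟩,
    ⟨inferInstance, inferInstance, fun f => LAb.reflectsIsomorphisms_changeOfBase f⟩,
    fun h => LAb.not_isAccessible_lexSplExt (h _ _)⟩
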